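/- Setting. Let $\mathsf H$ be a separable complex Hilbert space, let $\hbar,c>0$, and let $\widehat M$ and $\widehat H$ be (possibly unbounded) self-adjoint operators on $\mathsf H$ with $\sigma(\widehat M)=\sigma_p(\widehat M)\subset(0,+\infty)$, such that the strongly continuous one-parameter unitary groups $e^{-itc^2\widehat M/\hbar}$ and $e^{-it\widehat H/\hbar}$ commute. The time evolution is $U_t:=e^{-itc^2\widehat M/\hbar}\,e^{-it\widehat H/\hbar}$. For $M\in\sigma_p(\widehat M)$ let $P_M$ be the orthogonal projector onto the eigenspace of $\widehat M$ with eigenvalue $M$, and for $A\in\mathfrak B(\mathsf H)$ put $A_B:=\sum_{M\in\sigma_p(\widehat M)}P_MAP_M$ (strong operator convergence). Let $\Psi=\sum_{M\in S}\Psi_M$ with $\|\Psi\|=1$, where $S\subset\sigma_p(\widehat M)$ is finite and each $\Psi_M\neq0$ is an eigenvector of $\widehat M$ with eigenvalue $M$ and belongs to the domain of $\widehat H$. Put $\rho_\Psi:=\sum_{M\in S}p_M\,\Phi_M\langle\Phi_M|\cdot\rangle$ with $p_M:=\|\Psi_M\|^2$, $\Phi_M:=\Psi_M/\|\Psi_M\|$.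 Let $N_\Psi$ be the number of elements of $S$, let $\delta M_\Psi>0$ be the smallest difference of two different elements of $S$, and let $$E_\Psi:=\max_{M\in S}\sqrt{\langle\widehat H\rangle_{\Psi_M}^2+(\Delta\widehat H_{\Psi_M})^2},$$ where, with $P^{(\widehat H)}$ the spectral measure of $\widehat H$, $\langle\widehat H\rangle_{\psi}:=\int\lambda\,d\langle\psi|P^{(\widehat H)}(\lambda)\psi\rangle$ and $\Delta\widehat H_\psi:=\bigl(\int(\lambda^2-\langle\widehat H\rangle_\psi^2)\,d\langle\psi|P^{(\widehat H)}(\lambda)\psi\rangle\bigr)^{1/2}$. Proposition (Effective superselection rule II). For every $A\in\mathfrak B(\mathsf H)$ and every $T>0$ the two integrands below are integrable on $[0,T]$ and $$\left|\frac1T\int_0^T\langle\Psi|U_t^*AU_t\Psi\rangle\,dt-\frac1T\int_0^T\mathrm{tr}\!\left(\rho_\Psi\,e^{it\widehat H/\hbar}A_B\,e^{-it\widehat H/\hbar}\right)dt\right|\le\frac{2\hbar N_\Psi^2\|A\|}{\delta M_\Psi c^2T}+\frac{2\|A\|N_\Psi^2E_\Psi}{\delta M_\Psi c^2}.$$ (If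 $S$ has a single element, so that $\delta M_\Psi$ is not defined, the two averages are equal and both terms on the right are read as $0$.) Consequently, when all the data ($\mathsf H,\hbar,c,\widehat M,\widehat H,\Psi,A,T$) vary along a filter (for instance a sequence) in such a way that $$\frac{2\|A\|N_\Psi^2E_\Psi}{\delta M_\Psi c^2}\to0\quad\text{and}\quad\frac{2\hbar N_\Psi^2\|A\|}{\delta M_\Psi c^2\,T}\to0,$$ that is, for $2\|A\|N_\Psi^2E_\Psi\ll\delta M_\Psi c^2$ and $T\gg 2\hbar N_\Psi^2\|A\|/(\delta M_\Psi c^2)$, the difference of the two time averages tends to $0$. No upper bound on $T$ is required. -/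

import Mathlib

open Filter Topology MeasureTheory
open scoped InnerProductSpace

noncomputable section

namespace MassSuperselection

universe u

/-! ### Unbounded operators: eigenspaces, spectrum, scalar spectral measures -/

section Operators

variable {E : Type u} [NormedAddCommGroup E] [InnerProductSpace ℂ E]

/-- The eigenspace `{ψ ∈ D(O) | O ψ = z ψ}` of a partially defined operator `O`
(it is `{0}` when `z` is not an eigenvalue). -/
def eigenspace (O : E →ₗ.[ℂ] E) (z : ℂ) : Submodule ℂ E where
  carrier := {ψ | ∃ h : ψ ∈ O.domain, O ⟨ψ, h⟩ = z • ψ}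
  zero_mem' := ⟨O.domain.zero_mem, by
    have h : (⟨0, O.domain.zero_mem⟩ : O.domain) = 0 := rfl
    rw [h, O.map_zero, smul_zero]⟩
  add_mem' := by
    rintro a b ⟨ha, ha'⟩ ⟨hb, hb'⟩
    refine ⟨O.domain.add_mem ha hb, ?_⟩
    have h : (⟨a + b, O.domain.add_mem ha hb⟩ : O.domain) = ⟨a, ha⟩ + ⟨b, hb⟩ := rfl
    rw [h, O.map_add, ha', hb', smul_add]
  smul_mem' := by
    rintro k a ⟨ha, ha'⟩
    refine ⟨O.domain.smul_mem k ha, ?_⟩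
    have h : (⟨k • a, O.domain.smul_mem k ha⟩ : O.domain) = k • ⟨a, ha⟩ := rfl
    rw [h, O.map_smul, ha', smul_comm]

/-- The point spectrum `σ_p(O)`: the set of eigenvalues. -/
def pointSpectrum (O : E →ₗ.[ℂ] E) : Set ℂ := {z | eigenspace O z ≠ ⊥}

/-- The resolvent set of `O`: those `z` for which `O - z : D(O) → E` has an everywhere defined
bounded two-sided inverse. -/
def resolventSet (O : E →ₗ.[ℂ] E) : Set ℂ :=
  {z | ∃ R : E →L[ℂ] E,
    (∀ ψ : E, ∃ h : R ψ ∈ O.domain, O ⟨R ψ, h⟩ - z • R ψ = ψ) ∧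
    (∀ φ : O.domain, R (O φ - z • (φ : E)) = φ)}

/-- The spectrum `σ(O)` of a partially defined operator. -/
def spectrum (O : E →ₗ.[ℂ] E) : Set ℂ := (resolventSet O)ᶜ

/-- `μ` is the measure `⟨ψ| P^{(O)}(·) ψ⟩`, where `P^{(O)}` is the projection-valued spectral measure
of the self-adjoint operator `O`. It is pinned down through the resolvent:
`⟨ψ, (O - z)⁻¹ ψ⟩ = ∫ (s - z)⁻¹ dμ(s)` for all non-real `z` (a finite measure on the line is
determined by these integrals, its Stieltjes transform). -/
def IsScalarSpectralMeasure (O : E →ₗ.[ℂ] E) (ψ : E) (μ : Measure ℝ) : Prop :=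
  IsFiniteMeasure μ ∧
    ∀ z : ℂ, z.im ≠ 0 → ∀ φ : O.domain, O φ - z • (φ : E) = ψ →
      ⟪ψ, (φ : E)⟫_ℂ = ∫ s : ℝ, ((s : ℂ) - z)⁻¹ ∂μ

open Classical in
/-- The scalar spectral measure `⟨ψ| P^{(O)}(·) ψ⟩` of `O` at `ψ`. For self-adjoint `O` it exists and
is unique; the value `0` is a default for operators that have none. -/
def scalarSpectralMeasure (O : E →ₗ.[ℂ] E) (ψ : E) : Measure ℝ :=
  if h : ∃ μ : Measure ℝ, IsScalarSpectralMeasure O ψ μ then h.choose else 0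

/-- `⟨O⟩_ψ = ∫ s d⟨ψ| P^{(O)}(s) ψ⟩`; the vector `ψ` is not normalised. -/
def mean (O : E →ₗ.[ℂ] E) (ψ : E) : ℝ := ∫ s : ℝ, s ∂(scalarSpectralMeasure O ψ)

/-- `ΔO_ψ = (∫ (s² - ⟨O⟩_ψ²) d⟨ψ| P^{(O)}(s) ψ⟩)^{1/2}`. -/
def deviation (O : E →ₗ.[ℂ] E) (ψ : E) : ℝ :=
  √(∫ s : ℝ, (s ^ 2 - mean O ψ ^ 2) ∂(scalarSpectralMeasure O ψ))

variable [CompleteSpace E]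

/-- The orthogonal projector `P_m` onto the eigenspace of `O` with eigenvalue `m`. (Eigenspaces of
a self-adjoint operator are closed; the closure makes the projector available for every `O`.) -/
def eigenProj (O : E →ₗ.[ℂ] E) (m : ℝ) : E →L[ℂ] E :=
  (eigenspace O (m : ℂ)).topologicalClosure.starProjection

/-- The permitted observable `A_B = ∑_m P_m A P_m`, the sum over the eigenvalues `m` of `O`
being taken in the strong operator topology. -/
def permitted (O : E →ₗ.[ℂ] E) (A : E →L[ℂ] E) : E →L[ℂ] E :=
  (∑' m : {m : ℝ // (m : ℂ) ∈ pointSpectrum O},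
    ContinuousLinearMap.toPointwiseConvergenceCLM ℂ (RingHom.id ℂ) E E
      (eigenProj O m ∘L A ∘L eigenProj O m) : E →Lₚₜ[ℂ] E)

/-- The trace `∑_i ⟨b_i, B b_i⟩`, computed in some Hilbert basis `b` of `E`; for a trace-class `B`
(in this file: an operator of finite rank) the choice of `b` does not matter. -/
def trace (B : E →L[ℂ] E) : ℂ :=
  ∑' i : (exists_hilbertBasis ℂ E).choose,
    ⟪(exists_hilbertBasis ℂ E).choose_spec.choose i,
      B ((exists_hilbertBasis ℂ E).choose_spec.choose i)⟫_ℂ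

/-- A strongly continuous one-parameter group of unitary operators. -/
structure UnitaryGroup (E : Type u) [NormedAddCommGroup E] [InnerProductSpace ℂ E]
    [CompleteSpace E] where
  op : ℝ → E →L[ℂ] E
  unitary : ∀ t, op t ∈ _root_.unitary (E →L[ℂ] E)
  zero : op 0 = 1
  add : ∀ s t, op (s + t) = op s * op t
  continuous : ∀ ψ, Continuous fun t => op t ψ

/-- The group is `t ↦ e^{-i t a O}`, in the sense of Stone's theorem: its self-adjoint generator
`ψ ↦ i (d/dt) U_t ψ |_{t = 0}`, defined on all `ψ` for which the derivative exists, is `a O`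
with domain `D(O)`. Used for `a ≠ 0` only. -/
def UnitaryGroup.IsExp (U : UnitaryGroup E) (a : ℝ) (O : E →ₗ.[ℂ] E) : Prop :=
  ∀ ψ φ : E, (∃ h : ψ ∈ O.domain, (a : ℂ) • O ⟨ψ, h⟩ = φ) ↔
    Tendsto (fun t : ℝ => (Complex.I / (t : ℂ)) • (U.op t ψ - ψ)) (𝓝[≠] 0) (𝓝 φ)

end Operators

/-! ### The physical system -/

/-- A quantum system on the Hilbert space `E` with mass operator `M̂` (self-adjoint with
`σ(M̂) = σ_p(M̂) ⊆ (0, ∞)`) and Hamiltonian `Ĥ` (self-adjoint), for which the time evolution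
is the product of the commuting groups `e^{-i t c² M̂ / ħ}` and `e^{-i t Ĥ / ħ}`. -/
structure System (E : Type u) [NormedAddCommGroup E] [InnerProductSpace ℂ E]
    [CompleteSpace E] where
  hbar : ℝ
  hbar_pos : 0 < hbar
  c : ℝ
  c_pos : 0 < c
  mass : E →ₗ.[ℂ] E
  mass_selfAdjoint : IsSelfAdjoint mass
  mass_spectrum : spectrum mass = pointSpectrum mass
  mass_pos : ∀ z ∈ spectrum mass, ∃ m : ℝ, 0 < m ∧ z = m
  ham : E →ₗ.[ℂ] E
  ham_selfAdjoint : IsSelfAdjoint ham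
  massGroup : UnitaryGroup E
  massGroup_isExp : massGroup.IsExp (c ^ 2 / hbar) mass
  hamGroup : UnitaryGroup E
  hamGroup_isExp : hamGroup.IsExp (1 / hbar) ham
  commute : ∀ s t, Commute (massGroup.op s) (hamGroup.op t)

/-- A unit vector `Ψ = ∑_{M ∈ S} Ψ_M`, where `S` is a finite set of eigenvalues of the mass
operator and `Ψ_M ≠ 0` is an eigenvector with eigenvalue `M` that lies in `D(Ĥ)`. -/
structure State {E : Type u} [NormedAddCommGroup E] [InnerProductSpace ℂ E] [CompleteSpace E]
    (Q : System E) where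
  S : Finset ℝ
  comp : ℝ → E
  comp_ne : ∀ M ∈ S, comp M ≠ 0
  comp_mass : ∀ M ∈ S, comp M ∈ eigenspace Q.mass (M : ℂ)
  comp_dom : ∀ M ∈ S, comp M ∈ Q.ham.domain
  norm_one : ‖∑ M ∈ S, comp M‖ = 1

variable {E : Type u} [NormedAddCommGroup E] [InnerProductSpace ℂ E] [CompleteSpace E]

/-- The time evolution `U_t = e^{-i t c² M̂ / ħ} e^{-i t Ĥ / ħ}`. -/
def System.evol (Q : System E) (t : ℝ) : E →L[ℂ] E := Q.massGroup.op t ∘L Q.hamGroup.op t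

namespace State

variable {Q : System E} (Ψ : State Q)

/-- The vector `Ψ` itself. -/
def vec : E := ∑ M ∈ Ψ.S, Ψ.comp M

/-- The density operator `ρ_Ψ = ∑_{M ∈ S} p_M Φ_M ⟨Φ_M| · ⟩`, with `p_M = ‖Ψ_M‖²` and
`Φ_M = Ψ_M / ‖Ψ_M‖`. -/
def density : E →L[ℂ] E :=
  ∑ M ∈ Ψ.S, ((‖Ψ.comp M‖ ^ 2 : ℝ) : ℂ) •
    InnerProductSpace.rankOne ℂ
      (((‖Ψ.comp M‖⁻¹ : ℝ) : ℂ) • Ψ.comp M) (((‖Ψ.comp M‖⁻¹ : ℝ) : ℂ) • Ψ.comp M)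

/-- `N_Ψ`, the number of elements of `S`. -/
def num : ℕ := Ψ.S.card

/-- `δM_Ψ`, the smallest difference of two different elements of `S`. (If `S` is a singleton there
is no such difference, and the value is `0`.) -/
def gap : ℝ := (Ψ.S : Set ℝ).infsep

theorem nonempty : Ψ.S.Nonempty := by
  rw [Finset.nonempty_iff_ne_empty]
  intro h
  have := Ψ.norm_one
  simp [h] at this

/-- The energy `E_Ψ = max_{M ∈ S} (⟨Ĥ⟩²_{Ψ_M} + (ΔĤ_{Ψ_M})²)^{1/2}`. -/
def energy : ℝ :=
  Ψ.S.sup' Ψ.nonempty fun M =>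
    √(mean Q.ham (Ψ.comp M) ^ 2 + deviation Q.ham (Ψ.comp M) ^ 2)

/-- The expectation value `⟨Ψ| U_t^* A U_t Ψ⟩`. -/
def expect (A : E →L[ℂ] E) (t : ℝ) : ℂ :=
  ⟪Ψ.vec, (ContinuousLinearMap.adjoint (Q.evol t) ∘L A ∘L Q.evol t) Ψ.vec⟫_ℂ

/-- `tr(ρ_Ψ e^{i t Ĥ / ħ} A_B e^{-i t Ĥ / ħ})`. -/
def expectPermitted (A : E →L[ℂ] E) (t : ℝ) : ℂ :=
  trace (Ψ.density ∘L Q.hamGroup.op (-t) ∘L permitted Q.mass A ∘L Q.hamGroup.op t)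

end State

/-- The time average `(1/T) ∫₀ᵀ f(t) dt`. -/
def timeAverage (T : ℝ) (f : ℝ → ℂ) : ℂ := (1 / (T : ℂ)) * ∫ t in (0 : ℝ)..T, f t

end MassSuperselection

end

/-! Since the two groups commute, `e^{-itĤ/ħ}` preserves each mass eigenspace, so on `Ψ_M` the mass
evolution is only the phase `e^{-itc²M/ħ}`. Hence `⟨Ψ|U_t^*AU_tΨ⟩` is a double sum over `S` of
phases `e^{itc²(M-M')/ħ}` times the correlations `corr`. The diagonal terms add up exactly to the
permitted expectation (`expectPermitted_eq_sum`), so only the off-diagonal terms have to be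
estimated.

Each of these is an oscillating exponential of frequency at least `c² δM/ħ` times an amplitude
bounded by `‖A‖` whose derivative is at most `2‖A‖E/ħ`. One integration by parts
(`norm_integral_exp_mul_le`) gives a boundary term, which the average divides by `T`, and an
integral term growing like `T`, which yields the contribution uniform in `T`.

The derivative bound needs `‖ĤΨ_M‖ ≤ E`, whereas `E` is defined by spectral moments. The spectral
measure is known only through its Stieltjes transform, so its existence (Cayley transform,
continuous functional calculus, Riesz–Markov) and its zeroth and second moments (resolvents at
`i(n+1)`) are established first. -/

namespace MassSuperselection

/-! ### Resolvents and the Cayley transform of a self-adjoint operator. -/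

section SelfAdjoint

variable {E : Type*} [NormedAddCommGroup E] [InnerProductSpace ℂ E] [CompleteSpace E]
  {O : E →ₗ.[ℂ] E}

theorem inner_apply_eq (hO : IsSelfAdjoint O) (x y : O.domain) :
    ⟪O x, (y : E)⟫_ℂ = ⟪(x : E), O y⟫_ℂ := by
  have h := LinearPMap.adjoint_isFormalAdjoint hO.dense_domain
  rw [LinearPMap.isSelfAdjoint_def.1 hO] at h
  exact h x y

theorem mem_domain_of_inner (hO : IsSelfAdjoint O) {y w : E}
    (h : ∀ x : O.domain, ⟪w, (x : E)⟫_ℂ = ⟪y, O x⟫_ℂ) : ∃ hy : y ∈ O.domain, O ⟨y, hy⟩ = w := by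
  have hy : y ∈ (O.adjoint).domain := LinearPMap.mem_adjoint_domain_of_exists y ⟨w, h⟩
  have h2 := LinearPMap.adjoint_apply_eq hO.dense_domain ⟨y, hy⟩ h
  have h3 := LinearPMap.isSelfAdjoint_def.1 hO
  obtain ⟨hd, he⟩ := LinearPMap.ext_iff.1 h3
  refine ⟨hd ▸ hy, ?_⟩
  rw [← h2]
  exact (@he y hy _).symm

theorem inner_apply_self_im (hO : IsSelfAdjoint O) (φ : O.domain) :
    (⟪(φ : E), O φ⟫_ℂ).im = 0 := by
  have h := inner_apply_eq hO φ φ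
  rw [← inner_conj_symm] at h
  exact Complex.conj_eq_iff_im.1 h

/-- The cross term vanishes because `⟪φ, O φ⟫` is real. All resolvent bounds below come from this
identity. -/
theorem norm_sq_apply_sub (hO : IsSelfAdjoint O) (y : ℝ) (φ : O.domain) :
    ‖O φ - (Complex.I * y) • (φ : E)‖ ^ 2 = ‖O φ‖ ^ 2 + y ^ 2 * ‖(φ : E)‖ ^ 2 := by
  rw [@norm_sub_sq ℂ, inner_smul_right, inner_apply_eq hO, norm_smul]
  have := inner_apply_self_im hO φ
  simp [this, mul_pow]

/-- The linear map `O - iy` on the domain of `O`. -/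
def shift (O : E →ₗ.[ℂ] E) (y : ℝ) : O.domain →ₗ[ℂ] E :=
  O.toFun - (Complex.I * y) • O.domain.subtype

omit [CompleteSpace E] in
theorem shift_apply (y : ℝ) (φ : O.domain) :
    shift O y φ = O φ - (Complex.I * y) • (φ : E) := rfl

theorem norm_le_shift (hO : IsSelfAdjoint O) (y : ℝ) (φ : O.domain) :
    |y| * ‖(φ : E)‖ ≤ ‖shift O y φ‖ := by
  refine abs_le_of_sq_le_sq' ?_ (norm_nonneg _) |>.2
  rw [shift_apply, norm_sq_apply_sub hO, mul_pow, sq_abs]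
  nlinarith [sq_nonneg ‖O φ‖]

theorem apply_le_shift (hO : IsSelfAdjoint O) (y : ℝ) (φ : O.domain) :
    ‖O φ‖ ≤ ‖shift O y φ‖ := by
  refine abs_le_of_sq_le_sq' ?_ (norm_nonneg _) |>.2
  rw [shift_apply, norm_sq_apply_sub hO]
  nlinarith [sq_nonneg (y * ‖(φ : E)‖)]

theorem shift_injective (hO : IsSelfAdjoint O) {y : ℝ} (hy : y ≠ 0) :
    Function.Injective (shift O y) := by
  rw [injective_iff_map_eq_zero]
  intro φ hφ
  have h := norm_le_shift hO y φ
  rw [hφ, norm_zero] at h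
  have h2 : ‖(φ : E)‖ ≤ 0 := nonpos_of_mul_nonpos_right h (abs_pos.2 hy)
  exact Subtype.ext (norm_le_zero_iff.1 h2)

/-- The graph of `O` is closed, hence complete, and on it `(a, b) ↦ b - iy a` is bounded below in
the graph norm; the image of such a map is closed. -/
theorem isClosed_range_shift (hO : IsSelfAdjoint O) {y : ℝ} (hy : y ≠ 0) :
    IsClosed (LinearMap.range (shift O y) : Set E) := by
  have : CompleteSpace O.graph := hO.isClosed.completeSpace_coe
  let f : O.graph →L[ℂ] E :=
    (ContinuousLinearMap.snd ℂ E E - (Complex.I * y) • ContinuousLinearMap.fst ℂ E E) ∘L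
      O.graph.subtypeL
  have hf : ∀ x : O.graph, ∃ φ : O.domain, (x : E × E) = ((φ : E), O φ) := by
    rintro ⟨⟨a, b⟩, hx⟩
    obtain ⟨φ, h1, h2⟩ := (LinearPMap.mem_graph_iff O).1 hx
    exact ⟨φ, Prod.ext h1.symm h2.symm⟩
  have hr : (LinearMap.range (shift O y) : Set E) = Set.range f := by
    ext χ
    constructor
    · rintro ⟨φ, rfl⟩
      exact ⟨⟨_, LinearPMap.mem_graph O φ⟩, rfl⟩
    · rintro ⟨x, rfl⟩
      obtain ⟨φ, hφ⟩ := hf x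
      refine ⟨φ, ?_⟩
      simp [f, hφ, shift_apply]
  rw [hr]
  have hl : AntilipschitzWith (max 1 ‖y‖₊⁻¹) f := by
    refine f.antilipschitz_of_bound fun x => ?_
    obtain ⟨φ, hφ⟩ := hf x
    have h1 : f x = shift O y φ := by simp [f, hφ, shift_apply]
    have h2 : ‖x‖ = max ‖(φ : E)‖ ‖O φ‖ := by
      rw [← Prod.norm_mk, ← hφ]; rfl
    rw [h1, h2]
    push_cast
    have hy' : 0 < ‖y‖ := norm_pos_iff.2 hy
    refine max_le ?_ ?_
    · refine le_trans ?_ (mul_le_mul_of_nonneg_right (le_max_right _ _) (norm_nonneg _))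
      rw [inv_mul_eq_div, le_div_iff₀ hy', mul_comm]
      exact norm_le_shift hO y φ
    · refine le_trans ?_ (mul_le_mul_of_nonneg_right (le_max_left _ _) (norm_nonneg _))
      rw [one_mul]
      exact apply_le_shift hO y φ
  exact hl.isClosed_range f.uniformContinuous

theorem shift_surjective (hO : IsSelfAdjoint O) {y : ℝ} (hy : y ≠ 0) :
    Function.Surjective (shift O y) := by
  rw [← LinearMap.range_eq_top, ← (isClosed_range_shift hO hy).submodule_topologicalClosure_eq,
    Submodule.topologicalClosure_eq_top_iff, Submodule.eq_bot_iff]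
  intro w hw
  rw [Submodule.mem_orthogonal'] at hw
  -- A vector orthogonal to the range of `O - iy` lies in the domain of the adjoint, which is `O`,
  -- with eigenvalue `-iy`; injectivity of `O + iy` then kills it.
  have h : ∀ x : O.domain, ⟪-(Complex.I * y) • w, (x : E)⟫_ℂ = ⟪w, O x⟫_ℂ := by
    intro x
    have h1 := hw _ ⟨x, rfl⟩
    rw [shift_apply, inner_sub_right, inner_smul_right, sub_eq_zero] at h1
    rw [h1, inner_smul_left]
    simp
  obtain ⟨hd, he⟩ := mem_domain_of_inner hO h
  have h3 : shift O (-y) ⟨w, hd⟩ = 0 := by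
    rw [shift_apply, he]; simp
  have := shift_injective hO (neg_ne_zero.2 hy) (h3.trans (map_zero _).symm)
  exact congrArg Subtype.val this

theorem exists_resolvent (hO : IsSelfAdjoint O) {y : ℝ} (hy : y ≠ 0) :
    ∃ R : E →L[ℂ] E, (∀ χ, ∃ h : R χ ∈ O.domain, O ⟨R χ, h⟩ - (Complex.I * y) • R χ = χ) ∧
      (∀ φ : O.domain, R (O φ - (Complex.I * y) • (φ : E)) = φ) ∧ ∀ χ, |y| * ‖R χ‖ ≤ ‖χ‖ := by
  let e := LinearEquiv.ofBijective (shift O y) ⟨shift_injective hO hy, shift_surjective hO hy⟩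
  have he : ∀ χ, shift O y (e.symm χ) = χ := e.apply_symm_apply
  have hb : ∀ χ, |y| * ‖((e.symm χ : O.domain) : E)‖ ≤ ‖χ‖ := fun χ => by
    have := norm_le_shift hO y (e.symm χ)
    rwa [he] at this
  refine ⟨(O.domain.subtype ∘ₗ e.symm.toLinearMap).mkContinuous |y|⁻¹ fun χ => ?_, fun χ => ?_,
    fun φ => ?_, hb⟩
  · rw [inv_mul_eq_div, le_div_iff₀ (abs_pos.2 hy), mul_comm]
    exact hb χ
  · exact ⟨(e.symm χ).2, he χ⟩
  · exact congrArg Subtype.val (e.symm_apply_apply φ)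

/-- The Cayley transform of a self-adjoint operator. -/
theorem exists_cayley (hO : IsSelfAdjoint O) :
    ∃ V ∈ _root_.unitary (E →L[ℂ] E),
      ∀ φ : O.domain, V (O φ + Complex.I • (φ : E)) = O φ - Complex.I • (φ : E) := by
  obtain ⟨R, hR, hR', -⟩ := exists_resolvent hO (neg_ne_zero.2 (one_ne_zero (α := ℝ)))
  obtain ⟨P, hP, hP', -⟩ := exists_resolvent hO (one_ne_zero (α := ℝ))
  simp only [Complex.ofReal_neg, Complex.ofReal_one, mul_neg, mul_one, neg_smul,
    sub_neg_eq_add] at hR hR' hP hP'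
  -- With `R = (O + i)⁻¹` and `P = (O - i)⁻¹`, these are `(O - i)(O + i)⁻¹` and its inverse `(O +
  -- i)(O - i)⁻¹`.
  let V : E →L[ℂ] E := 1 - (2 * Complex.I) • R
  let W : E →L[ℂ] E := 1 + (2 * Complex.I) • P
  have hV : ∀ φ : O.domain, V (O φ + Complex.I • (φ : E)) = O φ - Complex.I • (φ : E) := fun φ => by
    simp only [V, sub_apply, one_apply_eq_self,
      smul_apply, hR']
    module
  have hW : ∀ φ : O.domain, W (O φ - Complex.I • (φ : E)) = O φ + Complex.I • (φ : E) := fun φ => by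
    simp only [W, add_apply, one_apply_eq_self,
      smul_apply, hP']
    module
  have hVW : V * W = 1 := by
    ext χ
    obtain ⟨h, hχ⟩ := hP χ
    change V (W χ) = χ
    conv_lhs => rw [← hχ]
    rw [hW ⟨_, h⟩, hV ⟨_, h⟩]
    exact hχ
  have hVV : star V * V = 1 := by
    rw [ContinuousLinearMap.star_eq_adjoint]
    refine (ContinuousLinearMap.norm_map_iff_adjoint_comp_self V).1 fun χ => ?_
    obtain ⟨h, hχ⟩ := hR χ
    have h1 := norm_sq_apply_sub hO 1 ⟨_, h⟩
    have h2 := norm_sq_apply_sub hO (-1) ⟨_, h⟩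
    simp only [Complex.ofReal_neg, Complex.ofReal_one, mul_neg, mul_one, neg_smul,
      sub_neg_eq_add] at h1 h2
    conv_lhs => rw [← hχ]
    conv_rhs => rw [← hχ]
    rw [hV ⟨_, h⟩]
    refine (sq_eq_sq₀ (norm_nonneg _) (norm_nonneg _)).1 ?_
    rw [h1, h2]; simp
  refine ⟨V, Unitary.mem_iff.2 ⟨hVV, ?_⟩, hV⟩
  have : star V = W := by
    rw [← mul_one (star V), ← hVW, ← mul_assoc, hVV, one_mul]
  rw [this, hVW]

end SelfAdjoint

/-! ### Spectral measures of bounded normal operators. -/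

section NormalOperator

variable {E : Type*} [NormedAddCommGroup E] [InnerProductSpace ℂ E] [CompleteSpace E]

theorem inner_cfcHom_ofReal {V : E →L[ℂ] E} (hV : IsStarNormal V) (ψ : E)
    (f : C(_root_.spectrum ℂ V, ℂ)) (hf : star f = f) :
    (⟪ψ, cfcHom hV f ψ⟫_ℂ).im = 0 := by
  have h : (cfcHom hV f).adjoint = cfcHom hV f := by
    rw [← ContinuousLinearMap.star_eq_adjoint, ← map_star, hf]
  rw [← Complex.conj_eq_iff_im, inner_conj_symm]
  conv_lhs => rw [← h, ContinuousLinearMap.adjoint_inner_left]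

/-- The scalar spectral measure of a bounded normal operator. -/
theorem exists_measure_inner_cfcHom {V : E →L[ℂ] E} (hV : IsStarNormal V) (ψ : E) :
    ∃ ν : Measure (_root_.spectrum ℂ V), IsFiniteMeasure ν ∧
      ∀ g : C(_root_.spectrum ℂ V, ℂ), ⟪ψ, cfcHom hV g ψ⟫_ℂ = ∫ w, g w ∂ν := by
  let X := _root_.spectrum ℂ V
  let ι : C(X, ℝ) → C(X, ℂ) := fun f => ⟨fun x => (f x : ℂ), by fun_prop⟩
  have hιs : ∀ f, star (ι f) = ι f := fun f => by ext x; simp [ι]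
  let Λ : CompactlySupportedContinuousMap X ℝ →ₚ[ℝ] ℝ :=
    PositiveLinearMap.mk₀
      { toFun := fun f => (⟪ψ, cfcHom hV (ι f.toContinuousMap) ψ⟫_ℂ).re
        map_add' := fun f g => by
          have : ι (f + g).toContinuousMap = ι f.toContinuousMap + ι g.toContinuousMap := by
            ext x; simp [ι]
          rw [this, map_add, add_apply, inner_add_right, Complex.add_re]
        map_smul' := fun r f => by
          have : ι (r • f).toContinuousMap = (r : ℂ) • ι f.toContinuousMap := by
            ext x; simp [ι]
          rw [this, map_smul, smul_apply, inner_smul_right]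
          simp }
      (by
        intro f hf
        -- Positivity: `f = g²` with `g` real, so `⟪ψ, f(V) ψ⟫ = ‖g(V) ψ‖²`.
        let g : C(X, ℝ) := ⟨fun x => √(f x), by fun_prop⟩
        have : ι f.toContinuousMap = star (ι g) * ι g := by
          rw [hιs]
          ext x
          have h0 : 0 ≤ f x := hf x
          have : f x = √(f x) * √(f x) := (Real.mul_self_sqrt h0).symm
          simp only [ι, g, ContinuousMap.coe_mk, ContinuousMap.mul_apply, ← Complex.ofReal_mul]
          rw [← this]; rfl
        change 0 ≤ (⟪ψ, cfcHom hV (ι f.toContinuousMap) ψ⟫_ℂ).re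
        rw [this, map_mul, map_star, ContinuousLinearMap.star_eq_adjoint,
          mul_apply_eq_comp, ContinuousLinearMap.adjoint_inner_right]
        exact inner_self_nonneg (𝕜 := ℂ))
  let ν := RealRMK.rieszMeasure Λ
  have hfin : IsFiniteMeasure ν := inferInstance
  have hreal : ∀ f : C(X, ℝ), ⟪ψ, cfcHom hV (ι f) ψ⟫_ℂ = ((∫ w, f w ∂ν : ℝ) : ℂ) := by
    intro f
    let f' : CompactlySupportedContinuousMap X ℝ := ⟨f, HasCompactSupport.of_compactSpace _⟩
    have h1 : ∫ w, f' w ∂ν = (⟪ψ, cfcHom hV (ι f) ψ⟫_ℂ).re := RealRMK.integral_rieszMeasure Λ f'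
    have h2 := inner_cfcHom_ofReal hV ψ (ι f) (hιs f)
    refine Complex.ext ?_ ?_
    · rw [Complex.ofReal_re, ← h1]; rfl
    · rw [h2, Complex.ofReal_im]
  refine ⟨ν, hfin, fun g => ?_⟩
  let a : C(X, ℝ) := ⟨fun x => (g x).re, by fun_prop⟩
  let b : C(X, ℝ) := ⟨fun x => (g x).im, by fun_prop⟩
  have hg : g = ι a + Complex.I • ι b := by
    ext x
    simp [ι, a, b, mul_comm Complex.I, Complex.re_add_im]
  have hi : Integrable g ν := g.continuous.integrable_of_hasCompactSupport
    (HasCompactSupport.of_compactSpace _)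
  have hre := integral_re_add_im hi
  rw [← hre]
  conv_lhs => rw [hg, map_add, map_smul, add_apply,
    smul_apply, inner_add_right, inner_smul_right, hreal, hreal]
  rw [mul_comm]
  rfl

end NormalOperator

/-! ### The circle as a parametrisation of the line. -/

section CayleyParameter

/-- A zero would force `|i - z| = |i + z|`, which holds only for real `z`. -/
theorem cayley_denom_ne_zero {w z : ℂ} (hw : ‖w‖ = 1) (hz : z.im ≠ 0) :
    (Complex.I - z) + (Complex.I + z) * w ≠ 0 := by
  intro h
  have h1 : Complex.I - z = -((Complex.I + z) * w) := eq_neg_of_add_eq_zero_left h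
  have h2 : ‖Complex.I - z‖ = ‖Complex.I + z‖ := by rw [h1, norm_neg, norm_mul, hw, mul_one]
  have h3 : Complex.normSq (Complex.I - z) = Complex.normSq (Complex.I + z) := by
    rw [Complex.normSq_eq_norm_sq, Complex.normSq_eq_norm_sq, h2]
  simp only [Complex.normSq_apply, Complex.sub_re, Complex.add_re, Complex.sub_im, Complex.add_im,
    Complex.I_re, Complex.I_im] at h3
  apply hz
  linarith

/-- The inverse Cayley transform from the unit circle to the line. -/
noncomputable def cayleyInv (w : ℂ) : ℝ := (Complex.I * (1 + w) / (1 - w)).re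

theorem measurable_cayleyInv : Measurable cayleyInv := by
  unfold cayleyInv
  fun_prop

theorem ofReal_cayleyInv {w : ℂ} (hw : ‖w‖ = 1) (h1 : w ≠ 1) :
    (cayleyInv w : ℂ) = Complex.I * (1 + w) / (1 - w) := by
  rw [cayleyInv, ← Complex.conj_eq_iff_re]
  have hw0 : w ≠ 0 := by rintro rfl; simp at hw
  have hc : (starRingEnd ℂ) w = w⁻¹ := (Complex.inv_eq_conj hw).symm
  have h2 : 1 - w ≠ 0 := sub_ne_zero.2 h1.symm
  have h3 : w - 1 ≠ 0 := sub_ne_zero.2 h1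
  simp only [map_div₀, map_mul, map_add, map_sub, map_one, Complex.conj_I, hc]
  have h4 : 1 - w⁻¹ ≠ 0 := by
    rw [sub_ne_zero]; intro h; exact h1 (inv_eq_one.1 h.symm)
  rw [div_eq_div_iff h4 h2]
  field_simp
  ring

theorem inv_cayleyInv_sub {w z : ℂ} (hw : ‖w‖ = 1) (h1 : w ≠ 1) (hz : z.im ≠ 0) :
    ((cayleyInv w : ℂ) - z)⁻¹ = (1 - w) / ((Complex.I - z) + (Complex.I + z) * w) := by
  have h2 : 1 - w ≠ 0 := sub_ne_zero.2 h1.symm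
  have h3 := cayley_denom_ne_zero hw hz
  rw [ofReal_cayleyInv hw h1, inv_eq_iff_eq_inv, inv_div, div_sub' h2]
  congr 1
  ring

end CayleyParameter

/-! ### Existence of the scalar spectral measure. -/

section Existence

variable {E : Type*} [NormedAddCommGroup E] [InnerProductSpace ℂ E] [CompleteSpace E]
  {O : E →ₗ.[ℂ] E}

theorem exists_isScalarSpectralMeasure (hO : IsSelfAdjoint O) (ψ : E) :
    ∃ μ : Measure ℝ, IsScalarSpectralMeasure O ψ μ := by
  obtain ⟨V, hVu, hV⟩ := exists_cayley hO
  have hVn : IsStarNormal V := ⟨by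
    rw [Commute, SemiconjBy, (Unitary.mem_iff.1 hVu).1, (Unitary.mem_iff.1 hVu).2]⟩
  obtain ⟨ν, hν, hint⟩ := exists_measure_inner_cfcHom hVn ψ
  have hcirc : ∀ w : _root_.spectrum ℂ V, ‖(w : ℂ)‖ = 1 := fun w => by
    simpa using spectrum.subset_circle_of_unitary hVu w.2
  let s : _root_.spectrum ℂ V → ℝ := fun w => cayleyInv w
  have hs : Measurable s := measurable_cayleyInv.comp measurable_subtype_coe
  -- The point `1` corresponds to infinity on the line, and `cayleyInv` has only a default value
  -- there. Discarding it loses nothing, as the function `g` below vanishes at `1`.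
  let D : Set (_root_.spectrum ℂ V) := {w | (w : ℂ) ≠ 1}
  have hD : MeasurableSet D := measurable_subtype_coe (measurableSet_singleton (1 : ℂ)).compl
  refine ⟨(ν.restrict D).map s, inferInstance, fun z hz φ hφ => ?_⟩
  let g : C(_root_.spectrum ℂ V, ℂ) :=
    ⟨fun w => (1 - w) / ((Complex.I - z) + (Complex.I + z) * w),
      Continuous.div (by fun_prop) (by fun_prop) fun w => cayley_denom_ne_zero (hcirc w) hz⟩
  have hg : cfcHom hVn g ψ = φ := by
    let idm : C(_root_.spectrum ℂ V, ℂ) := (ContinuousMap.id ℂ).restrict _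
    have hid : cfcHom hVn idm = V := cfcHom_id hVn
    -- Applied to `(O + i)φ`, which `V` sends to `(O - i)φ`, this identity becomes `g(V)(2iψ) =
    -- 2iφ`; thus `g(V)` acts as the resolvent.
    have hmul : g * ((Complex.I - z) • 1 + (Complex.I + z) • idm) = 1 - idm := by
      ext w
      simp only [g, idm, ContinuousMap.mul_apply, ContinuousMap.coe_mk, ContinuousMap.add_apply,
        ContinuousMap.smul_apply, ContinuousMap.one_apply, ContinuousMap.sub_apply, smul_eq_mul,
        mul_one, ContinuousMap.restrict_apply, ContinuousMap.id_apply]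
      exact div_mul_cancel₀ _ (cayley_denom_ne_zero (hcirc w) hz)
    have h1 := congrArg (cfcHom hVn) hmul
    rw [map_mul, map_add, map_smul, map_smul, map_sub, map_one, hid] at h1
    have h2 := congrArg (fun B : E →L[ℂ] E => B (O φ + Complex.I • (φ : E))) h1
    simp only [mul_apply_eq_comp, add_apply, smul_apply, sub_apply, one_apply_eq_self, hV] at h2
    have h3 : (Complex.I - z) • (O φ + Complex.I • (φ : E)) +
        (Complex.I + z) • (O φ - Complex.I • (φ : E)) = (2 * Complex.I) • ψ := by
      rw [← hφ]; module
    have h4 : O φ + Complex.I • (φ : E) - (O φ - Complex.I • (φ : E)) =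
        (2 * Complex.I) • (φ : E) := by module
    rw [h3, h4, map_smul] at h2
    exact smul_right_injective E (mul_ne_zero two_ne_zero Complex.I_ne_zero) h2
  rw [← hg, hint, integral_map hs.aemeasurable, ← setIntegral_eq_integral_of_forall_compl_eq_zero
    (s := D)]
  · refine setIntegral_congr_fun hD fun w hw => ?_
    exact (inv_cayleyInv_sub (hcirc w) hw hz).symm
  · intro w hw
    have : (w : ℂ) = 1 := not_not.1 hw
    simp [g, this]
  · exact (by fun_prop : Measurable fun x : ℝ => ((x : ℂ) - z)⁻¹).aestronglyMeasurable

theorem isScalarSpectralMeasure_scalarSpectralMeasure (hO : IsSelfAdjoint O) (ψ : E) :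
    IsScalarSpectralMeasure O ψ (scalarSpectralMeasure O ψ) := by
  have h := exists_isScalarSpectralMeasure hO ψ
  rw [scalarSpectralMeasure, dif_pos h]
  exact h.choose_spec

end Existence

/-! ### Zeroth and second moments from resolvents on the imaginary axis. -/

section Moments

variable {E : Type*} [NormedAddCommGroup E] [InnerProductSpace ℂ E] [CompleteSpace E]
  {O : E →ₗ.[ℂ] E}

/-- Take imaginary parts in the Stieltjes formula at `z = iy`: the left side gives `y‖φ‖²`, the
integrand `y/(s² + y²)`. -/
theorem norm_sq_resolvent_eq_integral (hO : IsSelfAdjoint O) {ψ : E} {μ : Measure ℝ}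
    (hμ : IsScalarSpectralMeasure O ψ μ) {y : ℝ} (hy : 0 < y) {φ : O.domain}
    (hφ : O φ - (Complex.I * y) • (φ : E) = ψ) :
    ‖(φ : E)‖ ^ 2 = ∫ s : ℝ, (s ^ 2 + y ^ 2)⁻¹ ∂μ := by
  have := hμ.1
  have him : (Complex.I * (y : ℂ)).im = y := by simp
  have h := hμ.2 (Complex.I * y) (by rw [him]; exact hy.ne') φ hφ
  have hinv : ∀ s : ℝ, ((s : ℂ) - Complex.I * y)⁻¹.im = y * (s ^ 2 + y ^ 2)⁻¹ := fun s => by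
    rw [Complex.inv_im, Complex.normSq_apply]
    simp [div_eq_mul_inv, sq]
  have hi : Integrable (fun s : ℝ => ((s : ℂ) - Complex.I * y)⁻¹) μ := by
    refine Integrable.of_bound (C := y⁻¹)
      (by fun_prop : Measurable fun s : ℝ => ((s : ℂ) - Complex.I * y)⁻¹).aestronglyMeasurable
      (Eventually.of_forall fun s => ?_)
    rw [norm_inv]
    refine inv_anti₀ hy ?_
    refine le_trans ?_ (Complex.abs_im_le_norm _)
    simp [abs_of_pos hy]
  have h2 := congrArg Complex.im h
  have h3 := integral_im hi
  simp only [RCLike.im_to_complex] at h3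
  rw [← h3] at h2
  simp only [hinv] at h2
  rw [integral_const_mul] at h2
  have h4 : (⟪ψ, (φ : E)⟫_ℂ).im = y * ‖(φ : E)‖ ^ 2 := by
    conv_lhs => rw [← hφ]
    rw [inner_sub_left, inner_apply_eq hO, inner_smul_left, inner_self_eq_norm_sq_to_K]
    have := inner_apply_self_im hO φ
    simp [this, ← Complex.ofReal_pow]
  exact mul_left_cancel₀ hy.ne' (h4.symm.trans h2)

/-- The operators `-i(n+1)R n` are contractions and tend strongly to `1`: on the dense domain the
error is `-R n (O χ')`, of order `1/n`, and contractivity extends the limit to every vector. -/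
theorem tendsto_norm_sq_resolvent (hO : IsSelfAdjoint O) {R : ℕ → E →L[ℂ] E}
    (hR : ∀ n, ∀ φ : O.domain, R n (O φ - (Complex.I * ((n + 1 : ℝ) : ℂ)) • (φ : E)) = φ)
    (hb : ∀ (n : ℕ) χ, (n + 1 : ℝ) * ‖R n χ‖ ≤ ‖χ‖) (χ : E) :
    Tendsto (fun n : ℕ => (n + 1 : ℝ) ^ 2 * ‖R n χ‖ ^ 2) atTop (𝓝 (‖χ‖ ^ 2)) := by
  let B : ℕ → E →L[ℂ] E := fun n => -((Complex.I * ((n + 1 : ℝ) : ℂ)) • R n)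
  have hpos : ∀ n : ℕ, (0 : ℝ) < n + 1 := fun n => by positivity
  have hBn : ∀ n χ, ‖B n χ‖ = (n + 1) * ‖R n χ‖ := fun n χ => by
    simp only [B, neg_apply, smul_apply, norm_neg, norm_smul, norm_mul, Complex.norm_I, one_mul,
      Complex.norm_real, Real.norm_of_nonneg (hpos n).le]
  have hB : Tendsto (fun n => B n χ) atTop (𝓝 χ) := by
    rw [Metric.tendsto_atTop]
    intro ε hε
    obtain ⟨χ', hχ', hd⟩ := Metric.dense_iff.1 hO.dense_domain χ (ε / 3) (by positivity)
    rw [Metric.mem_ball, dist_eq_norm] at hχ'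
    obtain ⟨N, hN⟩ := exists_nat_gt (‖O ⟨χ', hd⟩‖ / (ε / 3))
    refine ⟨N, fun n hn => ?_⟩
    rw [dist_eq_norm]
    have h1 : B n χ' - χ' = - R n (O ⟨χ', hd⟩) := by
      have h : R n (O ⟨χ', hd⟩ - (Complex.I * ((n + 1 : ℝ) : ℂ)) • χ') = χ' := hR n ⟨χ', hd⟩
      rw [map_sub, map_smul] at h
      simp only [B, neg_apply, smul_apply]
      linear_combination (norm := module) h
    have h2 : ‖R n (O ⟨χ', hd⟩)‖ < ε / 3 := by
      have hN' : ‖O ⟨χ', hd⟩‖ / (ε / 3) < n + 1 :=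
        hN.trans_le ((Nat.cast_le.2 hn).trans (by linarith))
      rw [div_lt_iff₀ (by positivity)] at hN'
      exact lt_of_mul_lt_mul_left ((hb n _).trans_lt hN') (hpos n).le
    have h3 : ‖B n (χ - χ')‖ ≤ ‖χ - χ'‖ := by rw [hBn]; exact hb n _
    have h4 : B n χ - χ = B n (χ - χ') + (B n χ' - χ') + (χ' - χ) := by
      rw [map_sub]; abel
    rw [h4, h1]
    refine (norm_add₃_le).trans_lt ?_
    rw [norm_neg]
    rw [norm_sub_rev χ χ'] at h3
    linarith
  have := (hB.norm).pow 2
  simpa only [hBn, mul_pow] using this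

theorem tendsto_succ_sq : Tendsto (fun n : ℕ => ((n : ℝ) + 1) ^ 2) atTop atTop :=
  (tendsto_pow_atTop two_ne_zero).comp (tendsto_atTop_add_const_right _ _
    tendsto_natCast_atTop_atTop)

/-- The zeroth and second moments of the scalar spectral measure at a vector of the domain. -/
theorem moments_of_isScalarSpectralMeasure (hO : IsSelfAdjoint O) (ψ : O.domain) {μ : Measure ℝ}
    (hμ : IsScalarSpectralMeasure O (ψ : E) μ) :
    μ.real Set.univ = ‖(ψ : E)‖ ^ 2 ∧ Integrable (fun s : ℝ => s ^ 2) μ ∧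
      ∫ s : ℝ, s ^ 2 ∂μ = ‖O ψ‖ ^ 2 := by
  have := hμ.1
  have hpos : ∀ n : ℕ, (0 : ℝ) < n + 1 := fun n => by positivity
  choose R hR hR' hb using fun n : ℕ => exists_resolvent hO (hpos n).ne'
  have hb' : ∀ (n : ℕ) χ, (n + 1 : ℝ) * ‖R n χ‖ ≤ ‖χ‖ := fun n χ => by
    simpa only [abs_of_pos (hpos n)] using hb n χ
  have hq : ∀ (n : ℕ) (s : ℝ), 0 < s ^ 2 + (n + 1 : ℝ) ^ 2 := fun n s =>
    add_pos_of_nonneg_of_pos (sq_nonneg s) (pow_pos (hpos n) 2)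
  -- A cutoff increasing to `1`, whose integral is `‖(n+1) R n ψ‖²`. It makes `s²` bounded, so no
  -- second moment is presupposed.
  let k : ℕ → ℝ → ℝ := fun n s => (n + 1 : ℝ) ^ 2 * (s ^ 2 + (n + 1 : ℝ) ^ 2)⁻¹
  have hk0 : ∀ n s, 0 ≤ k n s := fun n s =>
    mul_nonneg (sq_nonneg _) (inv_nonneg.2 (hq n s).le)
  have hk1 : ∀ n s, k n s ≤ 1 := fun n s => by
    simp only [k]
    rw [← div_eq_mul_inv, div_le_one (hq n s)]
    linarith [sq_nonneg s]
  have hkm : ∀ n, Measurable (k n) := fun n => by fun_prop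
  have hki : ∀ n, Integrable (k n) μ := fun n =>
    Integrable.of_bound (C := 1) (hkm n).aestronglyMeasurable (Eventually.of_forall fun s => by
      rw [Real.norm_of_nonneg (hk0 n s)]; exact hk1 n s)
  have hkc : ∀ n s, 1 - k n s = s ^ 2 * (s ^ 2 + (n + 1 : ℝ) ^ 2)⁻¹ := fun n s => by
    have := (hq n s).ne'
    simp only [k]; field_simp; ring
  have hkl : ∀ s, Tendsto (fun n => k n s) atTop (𝓝 1) := fun s => by
    have h1 : Tendsto (fun n : ℕ => s ^ 2 * (s ^ 2 + (n + 1 : ℝ) ^ 2)⁻¹) atTop (𝓝 (s ^ 2 * 0)) :=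
      (tendsto_inv_atTop_zero.comp (tendsto_atTop_add_const_left _ _ tendsto_succ_sq)).const_mul _
    have h2 := h1.const_sub 1
    simp only [← hkc, sub_sub_cancel, mul_zero, sub_zero] at h2
    exact h2
  have hRk : ∀ n : ℕ, (n + 1 : ℝ) ^ 2 * ‖R n ψ‖ ^ 2 = ∫ s, k n s ∂μ := fun n => by
    obtain ⟨h, he⟩ := hR n (ψ : E)
    rw [integral_const_mul, ← norm_sq_resolvent_eq_integral hO hμ (hpos n) (φ := ⟨_, h⟩) he]
  have hmass : μ.real Set.univ = ‖(ψ : E)‖ ^ 2 := by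
    have h1 := tendsto_norm_sq_resolvent hO hR' hb' (ψ : E)
    simp only [hRk] at h1
    have h2 : Tendsto (fun n => ∫ s, k n s ∂μ) atTop (𝓝 (∫ _, (1 : ℝ) ∂μ)) :=
      tendsto_integral_of_dominated_convergence (fun _ => 1)
        (fun n => (hkm n).aestronglyMeasurable) (integrable_const _)
        (fun n => Eventually.of_forall fun s => by
          rw [Real.norm_of_nonneg (hk0 n s)]; exact hk1 n s)
        (Eventually.of_forall hkl)
    have := tendsto_nhds_unique h2 h1
    simpa using this
  -- `R n` commutes with `O` on the domain, and `‖O R n ψ‖² = ‖ψ‖² - (n+1)²‖R n ψ‖²`, which is the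
  -- integral of `1 - k n` once the total mass is known.
  have hsec : ∀ n : ℕ, (n + 1 : ℝ) ^ 2 * ‖R n (O ψ)‖ ^ 2 = ∫ s, s ^ 2 * k n s ∂μ := fun n => by
    obtain ⟨h, he⟩ := hR n (ψ : E)
    have h1 := norm_sq_apply_sub hO (n + 1) ⟨_, h⟩
    rw [he] at h1
    have h2 : R n (O ψ) = O ⟨_, h⟩ := by
      have h3 := hR' n ψ
      rw [map_sub, map_smul] at h3
      rw [sub_eq_iff_eq_add.1 h3, sub_eq_iff_eq_add.1 he]
    have h4 : ‖R n (O ψ)‖ ^ 2 = ∫ s, (1 - k n s) ∂μ := by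
      rw [integral_sub (integrable_const _) (hki n), ← hRk, h2]
      simp only [integral_const, smul_eq_mul, mul_one, hmass]
      linarith
    rw [h4, ← integral_const_mul]
    refine integral_congr_ae (Eventually.of_forall fun s => ?_)
    simp only [hkc, k]; ring
  have hlim := tendsto_norm_sq_resolvent hO hR' hb' (O ψ)
  have hmono : ∀ s, Monotone fun n => k n s := fun s m n hmn => by
    have h1 : 1 - k n s ≤ 1 - k m s := by
      rw [hkc, hkc]
      refine mul_le_mul_of_nonneg_left (inv_anti₀ (hq m s) ?_) (sq_nonneg s)
      have : (m : ℝ) ≤ n := Nat.cast_le.2 hmn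
      gcongr
    linarith
  have hki2 : ∀ n, Integrable (fun s => s ^ 2 * k n s) μ := fun n => by
    refine Integrable.of_bound (C := (n + 1 : ℝ) ^ 2) (by fun_prop)
      (Eventually.of_forall fun s => ?_)
    rw [Real.norm_of_nonneg (mul_nonneg (sq_nonneg s) (hk0 n s))]
    have h1 : s ^ 2 * k n s = (n + 1 : ℝ) ^ 2 * (1 - k n s) := by rw [hkc]; simp only [k]; ring
    rw [h1]
    exact mul_le_of_le_one_right (sq_nonneg _) (by linarith [hk0 n s])
  -- Monotone convergence in the extended integral yields the value and the finiteness of the second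
  -- moment together.
  have hlint : ∫⁻ s, ENNReal.ofReal (s ^ 2) ∂μ = ENNReal.ofReal (‖O ψ‖ ^ 2) := by
    have h1 : Tendsto (fun n => ∫⁻ s, ENNReal.ofReal (s ^ 2 * k n s) ∂μ) atTop
        (𝓝 (∫⁻ s, ENNReal.ofReal (s ^ 2) ∂μ)) := by
      refine lintegral_tendsto_of_tendsto_of_monotone
        (fun n => (by fun_prop : Measurable fun s => ENNReal.ofReal (s ^ 2 * k n s)).aemeasurable)
        (Eventually.of_forall fun s m n hmn => ?_) (Eventually.of_forall fun s => ?_)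
      · exact ENNReal.ofReal_le_ofReal (mul_le_mul_of_nonneg_left (hmono s hmn) (sq_nonneg s))
      · have := (hkl s).const_mul (s ^ 2)
        rw [mul_one] at this
        exact (ENNReal.continuous_ofReal.tendsto _).comp this
    have h2 : ∀ n, ∫⁻ s, ENNReal.ofReal (s ^ 2 * k n s) ∂μ =
        ENNReal.ofReal ((n + 1 : ℝ) ^ 2 * ‖R n (O ψ)‖ ^ 2) := fun n => by
      rw [hsec, ofReal_integral_eq_lintegral_ofReal (hki2 n)
        (Eventually.of_forall fun s => mul_nonneg (sq_nonneg s) (hk0 n s))]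
    simp only [h2] at h1
    exact tendsto_nhds_unique h1 ((ENNReal.continuous_ofReal.tendsto _).comp hlim)
  have hint : Integrable (fun s : ℝ => s ^ 2) μ := by
    refine ⟨by fun_prop, ?_⟩
    rw [hasFiniteIntegral_iff_ofReal (Eventually.of_forall fun s => sq_nonneg s), hlint]
    exact ENNReal.ofReal_lt_top
  refine ⟨hmass, hint, ?_⟩
  rw [integral_eq_lintegral_of_nonneg_ae (Eventually.of_forall fun s => sq_nonneg s)
    hint.aestronglyMeasurable, hlint, ENNReal.toReal_ofReal (sq_nonneg _)]

/-- For a vector of norm at most one, the energy bounds the norm of the image. -/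
theorem norm_apply_le_sqrt_mean_deviation (hO : IsSelfAdjoint O) (ψ : O.domain)
    (hψ : ‖(ψ : E)‖ ≤ 1) :
    ‖O ψ‖ ≤ √(mean O (ψ : E) ^ 2 + deviation O (ψ : E) ^ 2) := by
  have hμ := isScalarSpectralMeasure_scalarSpectralMeasure hO (ψ : E)
  have := hμ.1
  obtain ⟨h0, hi, h2⟩ := moments_of_isScalarSpectralMeasure hO ψ hμ
  refine Real.le_sqrt_of_sq_le ?_
  -- An inequality suffices, so the truncation of `√` at negative arguments does no harm.
  have hd : ∫ s : ℝ, (s ^ 2 - mean O (ψ : E) ^ 2) ∂(scalarSpectralMeasure O (ψ : E)) ≤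
      deviation O (ψ : E) ^ 2 := by
    rw [deviation]
    set x := ∫ s : ℝ, (s ^ 2 - mean O (ψ : E) ^ 2) ∂(scalarSpectralMeasure O (ψ : E))
    rcases le_total 0 x with h | h
    · rw [Real.sq_sqrt h]
    · exact h.trans (sq_nonneg _)
  rw [integral_sub hi (integrable_const _), h2, integral_const, h0, smul_eq_mul] at hd
  -- The integral equals `‖O ψ‖² - ‖ψ‖² mean²`, because `ψ` is not normalised; `‖ψ‖ ≤ 1` lets
  -- `mean²` compensate the subtracted term.
  have h3 : ‖(ψ : E)‖ ^ 2 ≤ 1 := pow_le_one₀ (norm_nonneg _) hψ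
  nlinarith [sq_nonneg (mean O (ψ : E))]

end Moments

/-! ### Unitary groups, their derivatives and eigenspaces. -/

section Group

variable {E : Type*} [NormedAddCommGroup E] [InnerProductSpace ℂ E] [CompleteSpace E]
  {O : E →ₗ.[ℂ] E} (U : UnitaryGroup E)

theorem UnitaryGroup.adjoint_op (t : ℝ) : ContinuousLinearMap.adjoint (U.op t) = U.op (-t) := by
  have h1 : U.op t * U.op (-t) = 1 := by rw [← U.add, add_neg_cancel, U.zero]
  rw [← ContinuousLinearMap.star_eq_adjoint, ← mul_one (star (U.op t)), ← h1, ← mul_assoc,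
    (Unitary.mem_iff.1 (U.unitary t)).1, one_mul]

theorem UnitaryGroup.norm_op (t : ℝ) (ψ : E) : ‖U.op t ψ‖ = ‖ψ‖ :=
  (ContinuousLinearMap.norm_map_iff_adjoint_comp_self _).2
    (Unitary.mem_iff.1 (U.unitary t)).1 ψ

theorem UnitaryGroup.hasDerivAt {U : UnitaryGroup E} {a : ℝ} (hU : U.IsExp a O) (ψ : O.domain)
    (t : ℝ) : HasDerivAt (fun t => U.op t ψ) (U.op t ((-(Complex.I * a)) • O ψ)) t := by
  rw [hasDerivAt_iff_tendsto_slope_zero]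
  have h := (hU ψ ((a : ℂ) • O ψ)).1 ⟨ψ.2, rfl⟩
  have h2 := ((U.op t).continuous.tendsto _).comp (h.const_smul (-Complex.I))
  rw [smul_smul, neg_mul] at h2
  refine h2.congr fun s => ?_
  simp only [Function.comp_apply]
  rw [smul_smul, ← Complex.coe_smul, U.add, mul_apply_eq_comp, ← map_sub, ← map_smul]
  congr 2
  rw [neg_mul, ← mul_div_assoc, Complex.I_mul_I, neg_div, neg_neg, one_div, Complex.ofReal_inv]

/-- `B` can be applied to the difference quotient at `0`. Since the domain consists of all vectors
where that quotient converges, `B ψ` belongs to it. -/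
theorem UnitaryGroup.apply_mem_eigenspace {U : UnitaryGroup E} {a : ℝ} (ha : a ≠ 0)
    (hU : U.IsExp a O) {B : E →L[ℂ] E} (hB : ∀ t, Commute (U.op t) B) {z : ℂ} {ψ : E}
    (hψ : ψ ∈ eigenspace O z) : B ψ ∈ eigenspace O z := by
  obtain ⟨hd, he⟩ := hψ
  have h := (hU ψ ((a : ℂ) • z • ψ)).1 ⟨hd, by rw [he]⟩
  have h2 := (B.continuous.tendsto _).comp h
  obtain ⟨hd', he'⟩ := (hU (B ψ) (B ((a : ℂ) • z • ψ))).2 (h2.congr fun t => by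
    have h3 : B (U.op t ψ) = U.op t (B ψ) := congrArg (fun C : E →L[ℂ] E => C ψ) (hB t).eq.symm
    simp only [Function.comp_apply]
    rw [map_smul, map_sub, h3])
  refine ⟨hd', smul_right_injective E (Complex.ofReal_ne_zero.2 ha) ?_⟩
  simpa only [map_smul] using he'

theorem UnitaryGroup.op_apply_of_mem_eigenspace {U : UnitaryGroup E} {a : ℝ} (hU : U.IsExp a O)
    {m : ℝ} {ψ : E} (hψ : ψ ∈ eigenspace O (m : ℂ)) (t : ℝ) :
    U.op t ψ = Complex.exp (-(Complex.I * ((a * m * t : ℝ) : ℂ))) • ψ := by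
  obtain ⟨hd, he⟩ := hψ
  -- Undoing the expected phase gives a curve with zero derivative, hence constant.
  let g : ℝ → E := fun t => Complex.exp (Complex.I * ((a * m * t : ℝ) : ℂ)) • U.op t ψ
  have hg : ∀ t, HasDerivAt g 0 t := fun t => by
    have h1 := UnitaryGroup.hasDerivAt hU ⟨ψ, hd⟩ t
    have h2 : HasDerivAt (fun t : ℝ => Complex.exp (Complex.I * ((a * m * t : ℝ) : ℂ)))
        (Complex.exp (Complex.I * ((a * m * t : ℝ) : ℂ)) * (Complex.I * ((a * m : ℝ) : ℂ))) t := by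
      refine HasDerivAt.cexp (HasDerivAt.const_mul _ (HasDerivAt.ofReal_comp ?_))
      simpa using (hasDerivAt_id t).const_mul (a * m)
    have h3 := h2.smul h1
    rw [he, map_smul, map_smul] at h3
    rw [Complex.ofReal_mul a m] at h3
    dsimp only at h3
    refine h3.congr_deriv ?_
    module
  have hc := is_const_of_deriv_eq_zero (fun t => (hg t).differentiableAt) (fun t => (hg t).deriv) t 0
  simp only [g, mul_zero, Complex.ofReal_zero, Complex.exp_zero, one_smul, U.zero,
    one_apply_eq_self] at hc
  conv_rhs => rw [← hc]
  rw [smul_smul, ← Complex.exp_add, neg_add_cancel, Complex.exp_zero, one_smul]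

end Group

/-! ### Strong summability of the compressions and matrix elements of `A_B`. -/

section Permitted

variable {E : Type*} [NormedAddCommGroup E] [InnerProductSpace ℂ E] [CompleteSpace E]
  {O : E →ₗ.[ℂ] E}

theorem inner_eq_zero_of_mem_eigenspace (hO : IsSelfAdjoint O) {m m' : ℝ} (hm : m ≠ m') {ψ φ : E}
    (hψ : ψ ∈ eigenspace O (m : ℂ)) (hφ : φ ∈ eigenspace O (m' : ℂ)) : ⟪ψ, φ⟫_ℂ = 0 := by
  obtain ⟨h1, e1⟩ := hψ
  obtain ⟨h2, e2⟩ := hφ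
  have h := inner_apply_eq hO ⟨ψ, h1⟩ ⟨φ, h2⟩
  rw [e1, e2, inner_smul_left, inner_smul_right, Complex.conj_ofReal, ← sub_eq_zero,
    ← sub_mul] at h
  refine (mul_eq_zero.1 h).resolve_left ?_
  exact fun h => hm (Complex.ofReal_injective (sub_eq_zero.1 h))

theorem orthogonalFamily_eigenspace_closure (hO : IsSelfAdjoint O) :
    OrthogonalFamily ℂ
      (fun m : {m : ℝ // (m : ℂ) ∈ pointSpectrum O} => (eigenspace O (m : ℂ)).topologicalClosure)
      fun m => (eigenspace O (m : ℂ)).topologicalClosure.subtypeₗᵢ := by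
  refine OrthogonalFamily.of_pairwise fun m m' hm => ?_
  have h1 : eigenspace O (m : ℂ) ≤ (eigenspace O (m' : ℂ))ᗮ := fun ψ hψ => by
    rw [Submodule.mem_orthogonal]
    exact fun φ hφ => inner_eq_zero_of_mem_eigenspace hO (fun h => hm (Subtype.ext h.symm)) hφ hψ
  rw [Function.onFun, Submodule.isOrtho_iff_le, Submodule.orthogonal_closure]
  exact Submodule.topologicalClosure_minimal _ h1 (Submodule.isClosed_orthogonal _)

omit [CompleteSpace E] in
/-- Bessel's inequality for an orthogonal family of subspaces. -/
theorem sum_norm_sq_starProjection_le {ι : Type*} {V : ι → Submodule ℂ E}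
    [∀ i, (V i).HasOrthogonalProjection]
    (hV : OrthogonalFamily ℂ (fun i => V i) fun i => (V i).subtypeₗᵢ) (F : Finset ι) (ψ : E) :
    ∑ i ∈ F, ‖(V i).starProjection ψ‖ ^ 2 ≤ ‖ψ‖ ^ 2 := by
  let x : E := ∑ i ∈ F, (V i).starProjection ψ
  have h1 : ‖x‖ ^ 2 = ∑ i ∈ F, ‖(V i).starProjection ψ‖ ^ 2 :=
    hV.norm_sum (fun i => (V i).orthogonalProjectionOnto ψ) F
  have h2 : (⟪x, ψ⟫_ℂ) = ((∑ i ∈ F, ‖(V i).starProjection ψ‖ ^ 2 : ℝ) : ℂ) := by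
    rw [sum_inner, Complex.ofReal_sum]
    refine Finset.sum_congr rfl fun i _ => ?_
    have h3 : (V i).starProjection ((V i).starProjection ψ) = (V i).starProjection ψ :=
      Submodule.starProjection_eq_self_iff.2 (Submodule.starProjection_apply_mem _ _)
    have h4 := (V i).inner_starProjection_left_eq_right ((V i).starProjection ψ) ψ
    rw [h3] at h4
    rw [h4, inner_self_eq_norm_sq_to_K]
    simp
  have h3 : ‖x‖ ^ 2 ≤ ‖x‖ * ‖ψ‖ := by
    have h4 := norm_inner_le_norm (𝕜 := ℂ) x ψ
    rw [h2, ← h1, Complex.norm_real, Real.norm_of_nonneg (sq_nonneg _)] at h4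
    exact h4
  rw [← h1]
  rcases (norm_nonneg x).eq_or_lt with h | h
  · rw [← h]; simp
  · rw [sq] at h3
    exact pow_le_pow_left₀ h.le (le_of_mul_le_mul_left h3 h) 2

variable {ι : Type*} {V : ι → Submodule ℂ E} [∀ i, (V i).HasOrthogonalProjection]

omit [CompleteSpace E] in
theorem sum_norm_sq_compression_le
    (hV : OrthogonalFamily ℂ (fun i => V i) fun i => (V i).subtypeₗᵢ) (A : E →L[ℂ] E)
    (F : Finset ι) (ψ : E) :
    ∑ i ∈ F, ‖(V i).starProjection (A ((V i).starProjection ψ))‖ ^ 2 ≤ (‖A‖ * ‖ψ‖) ^ 2 := by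
  calc _ ≤ ∑ i ∈ F, ‖A‖ ^ 2 * ‖(V i).starProjection ψ‖ ^ 2 := by
        refine Finset.sum_le_sum fun i _ => ?_
        rw [← mul_pow]
        exact pow_le_pow_left₀ (norm_nonneg _)
          (((V i).norm_starProjection_apply_le _).trans (A.le_opNorm _)) 2
    _ ≤ _ := by
        rw [← Finset.mul_sum, mul_pow]
        exact mul_le_mul_of_nonneg_left (sum_norm_sq_starProjection_le hV F ψ) (sq_nonneg _)

/-- The terms are mutually orthogonal, so summability of their squared norms is enough, and Bessel's
inequality bounds these. -/
theorem summable_compression_apply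
    (hV : OrthogonalFamily ℂ (fun i => V i) fun i => (V i).subtypeₗᵢ) (A : E →L[ℂ] E) (ψ : E) :
    Summable fun i => ((V i).starProjection ∘L A ∘L (V i).starProjection) ψ := by
  refine (hV.summable_iff_norm_sq_summable
    (fun i => (V i).orthogonalProjectionOnto (A ((V i).starProjection ψ)))).2 ?_
  exact summable_of_sum_le (fun i => sq_nonneg _) fun F => sum_norm_sq_compression_le hV A F ψ

/-- The compressions of a bounded operator to an orthogonal family of subspaces are strongly
summable. -/
theorem summable_compression
    (hV : OrthogonalFamily ℂ (fun i => V i) fun i => (V i).subtypeₗᵢ) (A : E →L[ℂ] E) :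
    Summable fun i => (ContinuousLinearMap.toPointwiseConvergenceCLM ℂ (RingHom.id ℂ) E E
      ((V i).starProjection ∘L A ∘L (V i).starProjection) : E →Lₚₜ[ℂ] E) := by
  have hs := summable_compression_apply hV A
  let L : E →ₗ[ℂ] E :=
    { toFun := fun ψ => ∑' i, ((V i).starProjection ∘L A ∘L (V i).starProjection) ψ
      map_add' := fun ψ φ => by
        simp only [map_add]
        exact (hs ψ).tsum_add (hs φ)
      map_smul' := fun r ψ => by
        simp only [map_smul, RingHom.id_apply]
        exact (hs ψ).tsum_const_smul r }
  -- By Pythagoras every partial sum obeys this bound, so the pointwise limit is a bounded operator.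
  have hL : ∀ ψ, ‖L ψ‖ ≤ ‖A‖ * ‖ψ‖ := fun ψ => by
    refine le_of_tendsto (hs ψ).hasSum.norm (Eventually.of_forall fun F => ?_)
    have h1 : ‖∑ i ∈ F, ((V i).starProjection ∘L A ∘L (V i).starProjection) ψ‖ ^ 2 =
        ∑ i ∈ F, ‖(V i).starProjection (A ((V i).starProjection ψ))‖ ^ 2 :=
      hV.norm_sum (fun i => (V i).orthogonalProjectionOnto (A ((V i).starProjection ψ))) F
    exact (sq_le_sq₀ (norm_nonneg _) (by positivity)).1
      (h1.trans_le (sum_norm_sq_compression_le hV A F ψ))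
  let L' : E →Lₚₜ[ℂ] E := L.mkContinuous ‖A‖ hL
  refine ⟨L', ?_⟩
  rw [HasSum, PointwiseConvergenceCLM.tendsto_iff_forall_tendsto]
  intro ψ
  refine (hs ψ).hasSum.congr fun F => ?_
  exact (map_sum (PointwiseConvergenceCLM.evalCLM (RingHom.id ℂ) E ψ)
    (fun i => (ContinuousLinearMap.toPointwiseConvergenceCLM ℂ (RingHom.id ℂ) E E
      ((V i).starProjection ∘L A ∘L (V i).starProjection) : E →Lₚₜ[ℂ] E)) F).symm

theorem permitted_apply (hO : IsSelfAdjoint O) (A : E →L[ℂ] E) (ψ : E) :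
    permitted O A ψ = ∑' m : {m : ℝ // (m : ℂ) ∈ pointSpectrum O},
      eigenProj O m (A (eigenProj O m ψ)) :=
  (PointwiseConvergenceCLM.evalCLM (RingHom.id ℂ) E ψ).map_tsum
    (summable_compression (orthogonalFamily_eigenspace_closure hO) A)

theorem eigenProj_apply_of_mem {m : ℝ} {ψ : E} (hψ : ψ ∈ eigenspace O (m : ℂ)) :
    eigenProj O m ψ = ψ :=
  Submodule.starProjection_eq_self_iff.2 (Submodule.le_topologicalClosure _ hψ)

theorem eigenProj_apply_of_ne (hO : IsSelfAdjoint O) {m m' : ℝ} (hm : m' ≠ m) {ψ : E}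
    (hψ : ψ ∈ eigenspace O (m : ℂ)) : eigenProj O m' ψ = 0 := by
  rw [eigenProj, Submodule.starProjection_apply_eq_zero_iff, Submodule.orthogonal_closure,
    Submodule.mem_orthogonal]
  exact fun φ hφ => inner_eq_zero_of_mem_eigenspace hO hm hφ hψ

/-- Only the summand of index `m` survives on `ψ`, and its outer projector moves by symmetry onto
`φ`, which it fixes. -/
theorem inner_permitted_of_mem_eigenspace (hO : IsSelfAdjoint O) (A : E →L[ℂ] E) {m : ℝ} {ψ φ : E}
    (hψ : ψ ∈ eigenspace O (m : ℂ)) (hφ : φ ∈ eigenspace O (m : ℂ)) :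
    ⟪φ, permitted O A ψ⟫_ℂ = ⟪φ, A ψ⟫_ℂ := by
  -- For `ψ = 0` the number `m` need not be an eigenvalue, hence need not index a summand.
  by_cases h0 : ψ = 0
  · rw [h0, map_zero, map_zero]
  have hm : (m : ℂ) ∈ pointSpectrum O := fun h => h0 (by rwa [h, Submodule.mem_bot] at hψ)
  rw [permitted_apply hO, tsum_eq_single ⟨m, hm⟩]
  · rw [eigenProj_apply_of_mem hψ]
    rw [eigenProj, ← Submodule.inner_starProjection_left_eq_right]
    rw [← eigenProj, eigenProj_apply_of_mem hφ]
  · intro m' hm'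
    rw [eigenProj_apply_of_ne hO (fun h => hm' (Subtype.ext h)) hψ, map_zero, map_zero]

end Permitted

/-! ### The trace against the density operator. -/

section Trace

variable {E : Type*} [NormedAddCommGroup E] [InnerProductSpace ℂ E] [CompleteSpace E]
  {Q : System E}

theorem State.density_apply (Ψ : State Q) (x : E) :
    Ψ.density x = ∑ M ∈ Ψ.S, ⟪Ψ.comp M, x⟫_ℂ • Ψ.comp M := by
  rw [State.density, sum_apply]
  refine Finset.sum_congr rfl fun M hM => ?_
  have h : (‖Ψ.comp M‖ : ℂ) ≠ 0 := Complex.ofReal_ne_zero.2 (norm_ne_zero_iff.2 (Ψ.comp_ne M hM))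
  rw [smul_apply, InnerProductSpace.rankOne_apply, inner_smul_left, Complex.conj_ofReal,
    smul_smul, smul_smul]
  congr 1
  push_cast
  field_simp

/-- Parseval's identity for the pair `B† Ψ_M`, `Ψ_M`, summed over the finite set `S`, eliminates the
chosen Hilbert basis. -/
theorem State.trace_density_comp (Ψ : State Q) (B : E →L[ℂ] E) :
    trace (Ψ.density ∘L B) = ∑ M ∈ Ψ.S, ⟪Ψ.comp M, B (Ψ.comp M)⟫_ℂ := by
  rw [trace]
  set b := (exists_hilbertBasis ℂ E).choose_spec.choose
  have h : ∀ M ∈ Ψ.S, HasSum (fun i => ⟪ContinuousLinearMap.adjoint B (Ψ.comp M), b i⟫_ℂ *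
      ⟪b i, Ψ.comp M⟫_ℂ) ⟪ContinuousLinearMap.adjoint B (Ψ.comp M), Ψ.comp M⟫_ℂ :=
    fun M _ => b.hasSum_inner_mul_inner _ _
  have h2 := (hasSum_sum h).tsum_eq
  simp only [ContinuousLinearMap.adjoint_inner_left] at h2
  rw [← h2]
  refine tsum_congr fun i => ?_
  rw [ContinuousLinearMap.comp_apply, State.density_apply, inner_sum]
  exact Finset.sum_congr rfl fun M _ => inner_smul_right _ _ _

end Trace

/-! ### Oscillatory integrals. -/

/-- A slowly varying amplitude averages out against an oscillating exponential. -/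
theorem norm_integral_exp_mul_le {f f' : ℝ → ℂ} (hf : ∀ t, HasDerivAt f (f' t) t)
    (hf' : Continuous f') {K D : ℝ} (hK : ∀ t, ‖f t‖ ≤ K) (hD : ∀ t, ‖f' t‖ ≤ D) {k : ℝ}
    (hk : k ≠ 0) {T : ℝ} (hT : 0 ≤ T) :
    ‖∫ t in (0 : ℝ)..T, Complex.exp (Complex.I * ((k * t : ℝ) : ℂ)) * f t‖ ≤
      (2 * K + T * D) / |k| := by
  -- A primitive of the exponential, of constant modulus `1/|k|`: the source of the gain in the
  -- integration by parts.
  let v : ℝ → ℂ := fun t => Complex.exp (Complex.I * ((k * t : ℝ) : ℂ)) / (Complex.I * k)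
  have hk' : Complex.I * (k : ℂ) ≠ 0 :=
    mul_ne_zero Complex.I_ne_zero (Complex.ofReal_ne_zero.2 hk)
  have hv : ∀ t, HasDerivAt v (Complex.exp (Complex.I * ((k * t : ℝ) : ℂ))) t := fun t => by
    have h : HasDerivAt (fun t : ℝ => Complex.exp (Complex.I * ((k * t : ℝ) : ℂ)))
        (Complex.exp (Complex.I * ((k * t : ℝ) : ℂ)) * (Complex.I * k)) t := by
      refine HasDerivAt.cexp (HasDerivAt.const_mul _ (HasDerivAt.ofReal_comp ?_))
      simpa using (hasDerivAt_id t).const_mul k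
    simpa only [mul_div_cancel_right₀ _ hk'] using h.div_const (Complex.I * k)
  have hvn : ∀ t, ‖v t‖ = |k|⁻¹ := fun t => by
    have : ‖Complex.exp (Complex.I * ((k * t : ℝ) : ℂ))‖ = 1 := Complex.norm_exp_I_mul_ofReal _
    simp only [v]
    rw [norm_div, this, norm_mul, Complex.norm_I, one_mul, Complex.norm_real, Real.norm_eq_abs,
      one_div]
  have hvc : Continuous v := continuous_iff_continuousAt.2 fun t => (hv t).continuousAt
  have hparts := intervalIntegral.integral_mul_deriv_eq_deriv_mul (a := 0) (b := T)
    (fun t _ => hf t) (fun t _ => hv t) (hf'.intervalIntegrable _ _)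
    ((by fun_prop : Continuous fun t : ℝ =>
      Complex.exp (Complex.I * ((k * t : ℝ) : ℂ))).intervalIntegrable _ _)
  have hint : ‖∫ t in (0 : ℝ)..T, f' t * v t‖ ≤ D * |k|⁻¹ * |T - 0| := by
    refine intervalIntegral.norm_integral_le_of_norm_le_const fun t _ => ?_
    rw [norm_mul, hvn]
    exact mul_le_mul_of_nonneg_right (hD t) (by positivity)
  have hb : ∀ t, ‖f t * v t‖ ≤ K * |k|⁻¹ := fun t => by
    rw [norm_mul, hvn]
    exact mul_le_mul_of_nonneg_right (hK t) (by positivity)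
  simp only [mul_comm (Complex.exp _)]
  rw [hparts]
  rw [sub_zero, abs_of_nonneg hT] at hint
  calc _ ≤ ‖f T * v T‖ + ‖f 0 * v 0‖ + ‖∫ t in (0 : ℝ)..T, f' t * v t‖ :=
        (norm_sub_le _ _).trans (add_le_add_left (norm_sub_le _ _) _)
    _ ≤ K * |k|⁻¹ + K * |k|⁻¹ + D * |k|⁻¹ * T := by gcongr <;> apply hb
    _ = _ := by rw [div_eq_mul_inv]; ring

/-! ### Correlations and the bound on the time averages. -/

namespace State

variable {E : Type*} [NormedAddCommGroup E] [InnerProductSpace ℂ E] [CompleteSpace E]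
  {Q : System E} (Ψ : State Q) (A : E →L[ℂ] E)

/-- Different mass components are orthogonal, so `⟪Ψ_M, Ψ⟫ = ‖Ψ_M‖²`, and Cauchy–Schwarz with `‖Ψ‖ =
1` concludes. -/
theorem norm_comp_le_one {M : ℝ} (hM : M ∈ Ψ.S) : ‖Ψ.comp M‖ ≤ 1 := by
  have h1 : ⟪Ψ.comp M, ∑ M' ∈ Ψ.S, Ψ.comp M'⟫_ℂ = ((‖Ψ.comp M‖ ^ 2 : ℝ) : ℂ) := by
    rw [inner_sum, Finset.sum_eq_single_of_mem M hM, inner_self_eq_norm_sq_to_K]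
    · simp
    · exact fun M' hM' h => inner_eq_zero_of_mem_eigenspace Q.mass_selfAdjoint h.symm
        (Ψ.comp_mass M hM) (Ψ.comp_mass M' hM')
  have h2 := norm_inner_le_norm (𝕜 := ℂ) (Ψ.comp M) (∑ M' ∈ Ψ.S, Ψ.comp M')
  rw [h1, Ψ.norm_one, mul_one, Complex.norm_real, Real.norm_of_nonneg (sq_nonneg _), sq] at h2
  exact le_of_mul_le_mul_left (by rwa [mul_one]) (norm_pos_iff.2 (Ψ.comp_ne M hM))

theorem norm_ham_apply_le_energy {M : ℝ} (hM : M ∈ Ψ.S) :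
    ‖Q.ham ⟨Ψ.comp M, Ψ.comp_dom M hM⟩‖ ≤ Ψ.energy :=
  (norm_apply_le_sqrt_mean_deviation Q.ham_selfAdjoint ⟨Ψ.comp M, Ψ.comp_dom M hM⟩
    (Ψ.norm_comp_le_one hM)).trans
    (Finset.le_sup' (fun M => √(mean Q.ham (Ψ.comp M) ^ 2 + deviation Q.ham (Ψ.comp M) ^ 2)) hM)

theorem energy_nonneg : 0 ≤ Ψ.energy :=
  (norm_nonneg _).trans (Ψ.norm_ham_apply_le_energy Ψ.nonempty.choose_spec)

/-- The correlation `⟨e^{-itĤ/ħ} Ψ_M | A e^{-itĤ/ħ} Ψ_M'⟩`. -/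
noncomputable def corr (M M' t : ℝ) : ℂ :=
  ⟪Q.hamGroup.op t (Ψ.comp M), A (Q.hamGroup.op t (Ψ.comp M'))⟫_ℂ

theorem continuous_corr (M M' : ℝ) : Continuous (Ψ.corr A M M') :=
  (Q.hamGroup.continuous _).inner (A.continuous.comp (Q.hamGroup.continuous _))

theorem norm_corr_le {M M' : ℝ} (hM : M ∈ Ψ.S) (hM' : M' ∈ Ψ.S) (t : ℝ) :
    ‖Ψ.corr A M M' t‖ ≤ ‖A‖ := by
  refine (norm_inner_le_norm _ _).trans ?_
  rw [UnitaryGroup.norm_op]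
  calc _ ≤ 1 * (‖A‖ * 1) := by
        gcongr
        · exact Ψ.norm_comp_le_one hM
        · refine A.le_of_opNorm_le_of_le le_rfl ?_
          rw [UnitaryGroup.norm_op]
          exact Ψ.norm_comp_le_one hM'
    _ = ‖A‖ := by ring

theorem hamGroup_comp_mem_eigenspace {M : ℝ} (hM : M ∈ Ψ.S) (t : ℝ) :
    Q.hamGroup.op t (Ψ.comp M) ∈ eigenspace Q.mass (M : ℂ) :=
  UnitaryGroup.apply_mem_eigenspace (div_ne_zero (pow_ne_zero 2 Q.c_pos.ne') Q.hbar_pos.ne')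
    Q.massGroup_isExp (fun s => Q.commute s t) (Ψ.comp_mass M hM)

theorem expect_eq_sum (t : ℝ) :
    Ψ.expect A t = ∑ p ∈ Ψ.S ×ˢ Ψ.S,
      Complex.exp (Complex.I * ((Q.c ^ 2 / Q.hbar * (p.1 - p.2) * t : ℝ) : ℂ)) *
        Ψ.corr A p.1 p.2 t := by
  have h : Q.evol t Ψ.vec = ∑ M ∈ Ψ.S,
      Complex.exp (-(Complex.I * ((Q.c ^ 2 / Q.hbar * M * t : ℝ) : ℂ))) •
        Q.hamGroup.op t (Ψ.comp M) := by
    rw [State.vec, map_sum]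
    exact Finset.sum_congr rfl fun M hM => UnitaryGroup.op_apply_of_mem_eigenspace
      Q.massGroup_isExp (Ψ.hamGroup_comp_mem_eigenspace hM t) t
  rw [State.expect, ContinuousLinearMap.comp_apply, ContinuousLinearMap.adjoint_inner_right,
    ContinuousLinearMap.comp_apply, h, map_sum, sum_inner, Finset.sum_product]
  refine Finset.sum_congr rfl fun M _ => ?_
  rw [inner_sum]
  refine Finset.sum_congr rfl fun M' _ => ?_
  rw [map_smul, inner_smul_left, inner_smul_right, ← mul_assoc, ← Complex.exp_conj, ← Complex.exp_add,
    corr]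
  congr 2
  simp only [map_neg, map_mul, Complex.conj_I, Complex.conj_ofReal]
  push_cast
  ring

theorem expectPermitted_eq_sum (t : ℝ) :
    Ψ.expectPermitted A t = ∑ M ∈ Ψ.S, Ψ.corr A M M t := by
  rw [State.expectPermitted, State.trace_density_comp]
  refine Finset.sum_congr rfl fun M hM => ?_
  have h := Ψ.hamGroup_comp_mem_eigenspace hM t
  rw [ContinuousLinearMap.comp_apply, ContinuousLinearMap.comp_apply, ← UnitaryGroup.adjoint_op,
    ContinuousLinearMap.adjoint_inner_right, inner_permitted_of_mem_eigenspace Q.mass_selfAdjoint A h h,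
    corr]

theorem continuous_expect : Continuous (Ψ.expect A) := by
  rw [funext (Ψ.expect_eq_sum A)]
  have := Ψ.continuous_corr A
  fun_prop

theorem continuous_expectPermitted : Continuous (Ψ.expectPermitted A) := by
  rw [funext (Ψ.expectPermitted_eq_sum A)]
  exact continuous_finsetSum _ fun M _ => Ψ.continuous_corr A M M

theorem expect_sub_expectPermitted (t : ℝ) :
    Ψ.expect A t - Ψ.expectPermitted A t = ∑ p ∈ Ψ.S.offDiag,
      Complex.exp (Complex.I * ((Q.c ^ 2 / Q.hbar * (p.1 - p.2) * t : ℝ) : ℂ)) *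
        Ψ.corr A p.1 p.2 t := by
  rw [expect_eq_sum, expectPermitted_eq_sum, ← Finset.diag_union_offDiag,
    Finset.sum_union (Finset.disjoint_diag_offDiag _), Finset.sum_diag]
  simp

theorem gap_pos {M M' : ℝ} (hM : M ∈ Ψ.S) (hM' : M' ∈ Ψ.S) (h : M ≠ M') : 0 < Ψ.gap :=
  (Finset.infsep_pos_iff_nontrivial Ψ.S).2 ⟨M, hM, M', hM', h⟩

theorem gap_le {M M' : ℝ} (hM : M ∈ Ψ.S) (hM' : M' ∈ Ψ.S) (h : M ≠ M') : Ψ.gap ≤ |M - M'| := by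
  rw [← Real.dist_eq]
  exact Set.infsep_le_dist_of_mem hM hM' h

theorem norm_integral_corr_le {M M' : ℝ} (hM : M ∈ Ψ.S) (hM' : M' ∈ Ψ.S) (h : M ≠ M') {T : ℝ}
    (hT : 0 ≤ T) :
    ‖∫ t in (0 : ℝ)..T, Complex.exp (Complex.I * ((Q.c ^ 2 / Q.hbar * (M - M') * t : ℝ) : ℂ)) *
      Ψ.corr A M M' t‖ ≤
      2 * Q.hbar * ‖A‖ / (Ψ.gap * Q.c ^ 2) + T * (2 * ‖A‖ * Ψ.energy / (Ψ.gap * Q.c ^ 2)) := by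
  have hħ := Q.hbar_pos
  have hc := Q.c_pos
  have hg := Ψ.gap_pos hM hM' h
  have hE := Ψ.energy_nonneg
  let d : ∀ N ∈ Ψ.S, E := fun N hN =>
    (-(Complex.I * ((1 / Q.hbar : ℝ) : ℂ))) • Q.ham ⟨Ψ.comp N, Ψ.comp_dom N hN⟩
  have hd : ∀ N hN, ∀ t, HasDerivAt (fun t => Q.hamGroup.op t (Ψ.comp N))
      (Q.hamGroup.op t (d N hN)) t := fun N hN t =>
    UnitaryGroup.hasDerivAt Q.hamGroup_isExp ⟨Ψ.comp N, Ψ.comp_dom N hN⟩ t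
  have hdn : ∀ N hN, ‖d N hN‖ ≤ Ψ.energy / Q.hbar := fun N hN => by
    rw [norm_smul, norm_neg, norm_mul, Complex.norm_I, one_mul, Complex.norm_real,
      Real.norm_of_nonneg (by positivity), one_div, inv_mul_eq_div]
    exact div_le_div_of_nonneg_right (Ψ.norm_ham_apply_le_energy hN) hħ.le
  let f' : ℝ → ℂ := fun t => ⟪Q.hamGroup.op t (Ψ.comp M), A (Q.hamGroup.op t (d M' hM'))⟫_ℂ +
    ⟪Q.hamGroup.op t (d M hM), A (Q.hamGroup.op t (Ψ.comp M'))⟫_ℂ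
  have hf : ∀ t, HasDerivAt (Ψ.corr A M M') (f' t) t := fun t =>
    (hd M hM t).inner ℂ ((A.restrictScalars ℝ).hasFDerivAt.comp_hasDerivAt t (hd M' hM' t))
  have hf' : Continuous f' :=
    ((Q.hamGroup.continuous _).inner (A.continuous.comp (Q.hamGroup.continuous _))).add
      ((Q.hamGroup.continuous _).inner (A.continuous.comp (Q.hamGroup.continuous _)))
  have hA : ∀ (x y : E) (t : ℝ), ‖⟪Q.hamGroup.op t x, A (Q.hamGroup.op t y)⟫_ℂ‖ ≤
      ‖x‖ * (‖A‖ * ‖y‖) := fun x y t => by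
    refine (norm_inner_le_norm _ _).trans ?_
    rw [UnitaryGroup.norm_op]
    refine mul_le_mul_of_nonneg_left ?_ (norm_nonneg _)
    exact A.le_of_opNorm_le_of_le le_rfl (UnitaryGroup.norm_op _ _ _).le
  -- The factor `2` comes from differentiating both entries of the inner product.
  have hD : ∀ t, ‖f' t‖ ≤ 2 * ‖A‖ * Ψ.energy / Q.hbar := fun t => by
    calc _ ≤ ‖Ψ.comp M‖ * (‖A‖ * ‖d M' hM'‖) + ‖d M hM‖ * (‖A‖ * ‖Ψ.comp M'‖) :=
          (norm_add_le _ _).trans (add_le_add (hA _ _ _) (hA _ _ _))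
      _ ≤ 1 * (‖A‖ * (Ψ.energy / Q.hbar)) + Ψ.energy / Q.hbar * (‖A‖ * 1) := by
          gcongr
          · exact Ψ.norm_comp_le_one hM
          · exact hdn M' hM'
          · exact hdn M hM
          · exact Ψ.norm_comp_le_one hM'
      _ = _ := by ring
  have hk0 : Q.c ^ 2 / Q.hbar * Ψ.gap ≤ |Q.c ^ 2 / Q.hbar * (M - M')| := by
    rw [abs_mul, abs_of_pos (by positivity : 0 < Q.c ^ 2 / Q.hbar)]
    exact mul_le_mul_of_nonneg_left (Ψ.gap_le hM hM' h) (by positivity)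
  have hk : Q.c ^ 2 / Q.hbar * (M - M') ≠ 0 :=
    abs_pos.1 ((by positivity : 0 < Q.c ^ 2 / Q.hbar * Ψ.gap).trans_le hk0)
  refine (norm_integral_exp_mul_le hf hf' (Ψ.norm_corr_le A hM hM') hD hk hT).trans ?_
  refine (div_le_div_of_nonneg_left (by positivity) (by positivity) hk0).trans_eq ?_
  field_simp

theorem timeAverage_sub_le {T : ℝ} (hT : 0 < T) :
    ‖timeAverage T (Ψ.expect A) - timeAverage T (Ψ.expectPermitted A)‖ ≤
      2 * Q.hbar * (Ψ.num : ℝ) ^ 2 * ‖A‖ / (Ψ.gap * Q.c ^ 2 * T) +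
        2 * ‖A‖ * (Ψ.num : ℝ) ^ 2 * Ψ.energy / (Ψ.gap * Q.c ^ 2) := by
  have hħ := Q.hbar_pos
  have hc := Q.c_pos
  have hE := Ψ.energy_nonneg
  have hg : 0 ≤ Ψ.gap := Set.infsep_nonneg
  -- The bound for one off-diagonal pair. For a singleton `S` there are no pairs, and the gap `0`
  -- makes `b = 0` through division by zero, consistent with equality of the averages.
  set b := 2 * Q.hbar * ‖A‖ / (Ψ.gap * Q.c ^ 2) + T * (2 * ‖A‖ * Ψ.energy / (Ψ.gap * Q.c ^ 2))
    with hb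
  have hb0 : 0 ≤ b := by positivity
  -- There are `N² - N` pairs; the stated bound rounds this up to `N²`.
  have hcard : (Ψ.S.offDiag.card : ℝ) ≤ (Ψ.num : ℝ) ^ 2 := by
    rw [Finset.offDiag_card, State.num, sq]
    exact_mod_cast Nat.sub_le _ _
  have hI : ‖∫ t in (0 : ℝ)..T, (Ψ.expect A t - Ψ.expectPermitted A t)‖ ≤ (Ψ.num : ℝ) ^ 2 * b := by
    simp only [expect_sub_expectPermitted]
    rw [intervalIntegral.integral_finsetSum fun p _ => ?_]
    · refine (norm_sum_le _ _).trans ((Finset.sum_le_card_nsmul _ _ b fun p hp => ?_).trans ?_)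
      · obtain ⟨h1, h2, h3⟩ := Finset.mem_offDiag.1 hp
        exact Ψ.norm_integral_corr_le A h1 h2 h3 hT.le
      · rw [nsmul_eq_mul]
        exact mul_le_mul_of_nonneg_right hcard hb0
    · have := Ψ.continuous_corr A p.1 p.2
      exact Continuous.intervalIntegrable (by fun_prop) _ _
  rw [timeAverage, timeAverage, ← mul_sub, ← intervalIntegral.integral_sub
    ((Ψ.continuous_expect A).intervalIntegrable _ _)
    ((Ψ.continuous_expectPermitted A).intervalIntegrable _ _), norm_mul, one_div, norm_inv,
    Complex.norm_real, Real.norm_of_nonneg hT.le]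
  refine (mul_le_mul_of_nonneg_left hI (by positivity)).trans_eq ?_
  have h1 : T⁻¹ * ((Ψ.num : ℝ) ^ 2 * b) = (Ψ.num : ℝ) ^ 2 * (b / T) := by ring
  have h2 : b / T = 2 * Q.hbar * ‖A‖ / (Ψ.gap * Q.c ^ 2) / T +
      2 * ‖A‖ * Ψ.energy / (Ψ.gap * Q.c ^ 2) := by
    rw [hb, add_div, mul_div_cancel_left₀ _ hT.ne']
  rw [h1, h2, div_div]
  ring

end State

end MassSuperselection

theorem mainTheorem2 {ι : Type*} (l : Filter ι) (E : ι → Type*)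
    [∀ j, NormedAddCommGroup (E j)] [∀ j, InnerProductSpace ℂ (E j)] [∀ j, CompleteSpace (E j)]
    [∀ j, TopologicalSpace.SeparableSpace (E j)]
    (Q : ∀ j, MassSuperselection.System (E j)) (Ψ : ∀ j, MassSuperselection.State (Q j)) (A : ∀ j, E j →L[ℂ] E j)
    (T : ι → ℝ) (hT : ∀ j, 0 < T j) :
    (∀ j,
      IntervalIntegrable ((Ψ j).expect (A j)) volume 0 (T j) ∧
      IntervalIntegrable ((Ψ j).expectPermitted (A j)) volume 0 (T j) ∧
      ‖MassSuperselection.timeAverage (T j) ((Ψ j).expect (A j)) -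
          MassSuperselection.timeAverage (T j) ((Ψ j).expectPermitted (A j))‖ ≤
        2 * (Q j).hbar * ((Ψ j).num : ℝ) ^ 2 * ‖A j‖ / ((Ψ j).gap * (Q j).c ^ 2 * T j) +
        2 * ‖A j‖ * ((Ψ j).num : ℝ) ^ 2 * (Ψ j).energy / ((Ψ j).gap * (Q j).c ^ 2)) ∧
    (Tendsto (fun j => 2 * ‖A j‖ * ((Ψ j).num : ℝ) ^ 2 * (Ψ j).energy /
        ((Ψ j).gap * (Q j).c ^ 2)) l (𝓝 0) →
      Tendsto (fun j => 2 * (Q j).hbar * ((Ψ j).num : ℝ) ^ 2 * ‖A j‖ /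
        ((Ψ j).gap * (Q j).c ^ 2) / T j) l (𝓝 0) →
      Tendsto (fun j => MassSuperselection.timeAverage (T j) ((Ψ j).expect (A j)) -
        MassSuperselection.timeAverage (T j) ((Ψ j).expectPermitted (A j))) l (𝓝 0)) := by
  have hbound := fun j => (Ψ j).timeAverage_sub_le (A j) (hT j)
  refine ⟨fun j => ⟨((Ψ j).continuous_expect (A j)).intervalIntegrable _ _,
    ((Ψ j).continuous_expectPermitted (A j)).intervalIntegrable _ _, hbound j⟩, fun h1 h2 => ?_⟩
  refine squeeze_zero_norm hbound ?_
  simpa only [div_div, add_zero] using h2.add h1
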